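/- Let $U\subseteq\mathbb R^3$ be open, let $H,C,\nu\in C^\infty(U,\mathbb R)$, and consider the system $$\frac{du}{dt}=\nu(u)\,(\nabla H(u)\times\nabla C(u)),\qquad u\in U. \tag{1}$$ Let $V\subseteq U$ be an open set on which $H$ and $C$ are functionally independent, i.e. $\nabla H(u)$ and $\nabla C(u)$ are linearly independent for every $u\in V$. Let $\gamma$ be a nonconstant periodic solution of (1), with period $T>0$, whose orbit $\Gamma=\{\gamma(t):0\le t\le T\}$ lies in $V$, and suppose that $\Gamma\subseteq (H,C)^{-1}(\{(h,c)\})$, where $(h,c)$ is a regular value of $(H,C):U\to\mathbb R^2$, $h$ is a regular value of $H:U\to\mathbb R$ and $c$ is a regular value of $C:U\to\mathbb R$. Then for all smooth functions $\alpha,\beta\in C^\infty(V,(0,\infty))$, the curve $\gamma$ is also a $T$-periodic solution, with orbit $\Gamma$, of the perturbed system $$\frac{du}{dt}=\nu\,(\nabla H\times\nabla C)-\alpha\,(H-h)\,[\nabla C\times(\nabla H\times\nabla C)]+\beta\,(C-c)\,[\nabla H\times(\nabla H\times\nabla C)],\qquad u\in V, \tag{2}$$ and $\Gamma$ is orbitally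 phase asymptotically stable for (2) with respect to perturbations in $V$. That is, writing $x(t;x_0)$ for the solution of (2) in $V$ with $x(0;x_0)=x_0\in V$: 1. for every $\varepsilon>0$ there is $\delta>0$ such that for all $x_0\in V$ with $\operatorname{dist}(x_0,\Gamma)<\delta$, the solution $x(t;x_0)$ exists for all $t\ge 0$ and $\operatorname{dist}(x(t;x_0),\Gamma)<\varepsilon$ for all $t>0$; 2. there is $\delta>0$ such that for all $x_0\in V$ with $\operatorname{dist}(x_0,\Gamma)<\delta$, the solution exists for all $t\ge0$ and $\operatorname{dist}(x(t;x_0),\Gamma)\to0$ as $t\to\infty$; 3. there is $\delta>0$ such that for all $x_0\in V$ with $\operatorname{dist}(x_0,\Gamma)<\delta$, the solution exists for all $t\ge0$ and there is $\theta_0=\theta_0(x_0)\in\mathbb R$ with $\lim_{t\to\infty}\|x(t;x_0)-\gamma(t+\theta_0)\|=0$. Moreover, neither $H$ nor $C$ is conserved by (2), even near $\Gamma$: for every open set $W$ with $\Gamma\subseteq W\subseteq V$ there is a solution of (2) in $W$ along which $H$ is not constant, and there is a solution of (2) in $W$ along which $C$ is not constant. -/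

import Mathlib

open Set Filter Topology
open scoped ContDiff

/-- Three-dimensional Euclidean space. -/
abbrev E3 : Type := EuclideanSpace ℝ (Fin 3)

noncomputable section

namespace E3

/-- The cross product of two vectors of Euclidean 3-space. -/
def cross (a b : E3) : E3 :=
  WithLp.toLp 2 (crossProduct (WithLp.ofLp a) (WithLp.ofLp b))

/-- The vector field `ν (∇H × ∇C)`. -/
def hamField (ν H C : E3 → ℝ) (u : E3) : E3 :=
  ν u • cross (gradient H u) (gradient C u)

/-- The perturbed vector field
`ν (∇H × ∇C) - α (H - h) [∇C × (∇H × ∇C)] + β (C - c) [∇H × (∇H × ∇C)]`. -/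
def perturbedField (ν H C α β : E3 → ℝ) (h c : ℝ) (u : E3) : E3 :=
  hamField ν H C u
    - (α u * (H u - h)) •
        cross (gradient C u) (cross (gradient H u) (gradient C u))
    + (β u * (C u - c)) •
        cross (gradient H u) (cross (gradient H u) (gradient C u))

/-- `H` and `C` are functionally independent on `V`: their gradients are linearly independent
at every point of `V`. -/
def FunctionallyIndependentOn (H C : E3 → ℝ) (V : Set E3) : Prop :=
  ∀ u ∈ V, LinearIndependent ℝ ![gradient H u, gradient C u]

end E3

section DynamicalSystems

variable {E F : Type*} [NormedAddCommGroup E] [NormedSpace ℝ E]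
  [NormedAddCommGroup F] [NormedSpace ℝ F]

/-- `y` is a regular value of the map `f : U → F` (`U` an open set): the derivative of `f` is
onto at every point of `U` that `f` maps to `y`. -/
def IsRegularValueOn (f : E → F) (U : Set E) (y : F) : Prop :=
  ∀ u ∈ U, f u = y → Function.Surjective (fderiv ℝ f u)

/-- `x` is, on the time interval `I`, a solution of `dx/dt = X x` that stays in the domain `D`. -/
def IsSolutionOn (X : E → E) (D : Set E) (x : ℝ → E) (I : Set ℝ) : Prop :=
  (∀ t ∈ I, x t ∈ D) ∧ IsIntegralCurveOn x (fun _ => X) I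

/-- `x` is a solution of `dx/dt = X x` in `D`, defined for all `t ≥ 0`, starting at `x₀`. -/
def IsForwardSolution (X : E → E) (D : Set E) (x₀ : E) (x : ℝ → E) : Prop :=
  x 0 = x₀ ∧ IsSolutionOn X D x (Ici 0)

/-- The solution of `dx/dt = X x` in `D` starting at `x₀` exists for all `t ≥ 0` and has the
property `P`. -/
def ForwardSolutionSatisfies (X : E → E) (D : Set E) (x₀ : E) (P : (ℝ → E) → Prop) : Prop :=
  (∃ x, IsForwardSolution X D x₀ x) ∧ ∀ x, IsForwardSolution X D x₀ x → P x

/-- `Γ = {γ t : 0 ≤ t ≤ T}` is a (nonconstant) `T`-periodic orbit of `dx/dt = X x`, `x ∈ D`. -/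
structure IsPeriodicOrbit (X : E → E) (D : Set E) (γ : ℝ → E) (T : ℝ) (Γ : Set E) : Prop where
  period_pos : 0 < T
  periodic : Function.Periodic γ T
  solution : IsSolutionOn X D γ univ
  nonconstant : ∃ t, γ t ≠ γ 0
  orbit_eq : Γ = γ '' Icc 0 T

/-- The periodic orbit `Γ` of `dx/dt = X x`, `x ∈ D`, is orbitally stable. -/
def OrbitallyStable (X : E → E) (D : Set E) (Γ : Set E) : Prop :=
  ∀ ε > 0, ∃ δ > 0, ∀ x₀ ∈ D, Metric.infDist x₀ Γ < δ →
    ForwardSolutionSatisfies X D x₀ fun x => ∀ t > 0, Metric.infDist (x t) Γ < ε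

/-- The periodic orbit `Γ` of `dx/dt = X x`, `x ∈ D`, is orbitally asymptotically stable. -/
def OrbitallyAsymptoticallyStable (X : E → E) (D : Set E) (Γ : Set E) : Prop :=
  OrbitallyStable X D Γ ∧
  ∃ δ > 0, ∀ x₀ ∈ D, Metric.infDist x₀ Γ < δ →
    ForwardSolutionSatisfies X D x₀ fun x =>
      Tendsto (fun t => Metric.infDist (x t) Γ) atTop (𝓝 0)

/-- The periodic orbit `Γ`, parametrized by the periodic solution `γ`, of `dx/dt = X x`, `x ∈ D`,
is orbitally phase asymptotically stable. -/
def OrbitallyPhaseAsymptoticallyStable (X : E → E) (D : Set E) (γ : ℝ → E) (Γ : Set E) : Prop :=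
  OrbitallyAsymptoticallyStable X D Γ ∧
  ∃ δ > 0, ∀ x₀ ∈ D, Metric.infDist x₀ Γ < δ →
    ForwardSolutionSatisfies X D x₀ fun x =>
      ∃ θ₀ : ℝ, Tendsto (fun t => ‖x t - γ (t + θ₀)‖) atTop (𝓝 0)

/-- `f` is conserved by `dx/dt = X x` in `D`: it is constant along each solution in `D`. -/
def IsConservedOn (f : E → ℝ) (X : E → E) (D : Set E) : Prop :=
  ∀ (x : ℝ → E) (a b : ℝ), a ≤ b → IsSolutionOn X D x (Icc a b) → f (x a) = f (x b)

end DynamicalSystems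

end

/-! Put G = (H - h)² + (C - c)². Both added terms vanish on Γ, so γ remains a solution. The double
cross products decouple the damping: the H-gradient kills the C-term and conversely, and ∇H × ∇C is
orthogonal to both gradients. Along (2) this gives (H - h)' = -α‖∇H × ∇C‖² (H - h) and (C - c)' =
-β‖∇H × ∇C‖² (C - c). Independence and compactness bound both rates below by some κ > 0 near Γ, so G
decays like exp(-2κt) (`level_gap_le_of_isIntegralCurveOn`).

The velocity of γ is a nonzero multiple of ∇H × ∇C, hence the derivative of (H, C) is injective on
its orthogonal complement, and the distance to Γ is at most a multiple of √G near Γ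
(`eventually_infDist_le_level_gap`). Solutions starting near Γ are therefore trapped and approach it
exponentially. Sampled once per period they form a Cauchy sequence, whose limit on Γ supplies the
phase (`exists_asymptotic_phase`). The rates being nonzero off the level sets also rules out
conservation. -/

/-! ### Global flows, cutoffs, Gronwall and asymptotic phase. -/

section Flows

variable {E : Type*} [NormedAddCommGroup E] [NormedSpace ℝ E]

/-- A bounded, globally Lipschitz vector field has a global integral curve through each point. -/
theorem LipschitzWith.exists_isIntegralCurve [CompleteSpace E] {Y : E → E} {K L : NNReal}
    (hY : LipschitzWith K Y) (hL : ∀ u, ‖Y u‖ ≤ L) (x₀ : E) :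
    ∃ x : ℝ → E, x 0 = x₀ ∧ IsIntegralCurve x (fun _ => Y) := by
  have key : ∀ a : ℝ, 0 < a → ∃ x : ℝ → E, x 0 = x₀ ∧
      ∀ t ∈ Ioo (-a) a, HasDerivAt x (Y (x t)) t := by
    intro a ha
    -- Speed at most `L` keeps the curve within `L * a` of `x₀` up to time `a`, so Picard–Lindelöf
    -- applies on intervals of every length.
    have hp : IsPicardLindelof (fun _ => Y) (tmin := -a) (tmax := a)
        ⟨0, by constructor <;> linarith⟩ x₀ (L * ⟨a, ha.le⟩) 0 L K := by
      refine IsPicardLindelof.of_time_independent (fun u _ => hL u) (hY.lipschitzOnWith) ?_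
      simp
      exact le_refl _
    obtain ⟨x, hx0, hx⟩ := hp.exists_eq_forall_mem_Icc_hasDerivWithinAt₀
    exact ⟨x, hx0, fun t ht =>
      (hx t (Ioo_subset_Icc_self ht)).hasDerivAt (Icc_mem_nhds ht.1 ht.2)⟩
  choose! x hx0 hx using key
  have huniq : ∀ a b : ℝ, 0 < a → a ≤ b → EqOn (x a) (x b) (Ioo (-a) a) := by
    intro a b ha hab
    refine ODE_solution_unique_of_mem_Ioo (v := fun _ => Y) (s := fun _ => univ) (t₀ := 0)
      (K := K) (fun _ _ => hY.lipschitzOnWith) ⟨by linarith, ha⟩ (fun t ht => ⟨hx a ha t ht, trivial⟩)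
      (fun t ht => ⟨hx b (ha.trans_le hab) t ⟨by linarith [ht.1], by linarith [ht.2]⟩, trivial⟩) ?_
    rw [hx0 a ha, hx0 b (ha.trans_le hab)]
  -- Gluing: index `|t| + 1` always gives an interval containing `t` in its interior, and uniqueness
  -- makes the choice of index immaterial.
  have heq : ∀ a : ℝ, 0 < a → EqOn (fun t => x (|t| + 1) t) (x a) (Ioo (-a) a) := by
    intro a ha t ht
    rcases le_total (|t| + 1) a with h | h
    · exact huniq _ _ (by positivity) h (abs_lt.1 (by linarith))
    · exact (huniq _ _ ha h ht).symm
  refine ⟨fun t => x (|t| + 1) t, hx0 _ (by positivity), fun t => ?_⟩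
  have ht : t ∈ Ioo (-(|t| + 1)) (|t| + 1) := abs_lt.1 (by linarith)
  exact (hx _ (by positivity) t ht).congr_of_eventuallyEq
    (eventually_of_mem (Ioo_mem_nhds ht.1 ht.2) (heq _ (by positivity)))

/-- Near a compact subset of its open domain, a `C¹` vector field coincides with a bounded, globally
Lipschitz one. -/
theorem ContDiffOn.exists_lipschitzWith_eqOn_cthickening [FiniteDimensional ℝ E] {X : E → E}
    {V Γ : Set E} (hV : IsOpen V) (hX : ContDiffOn ℝ 1 X V) (hΓ : IsCompact Γ) (hΓV : Γ ⊆ V) :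
    ∃ r > 0, Metric.cthickening r Γ ⊆ V ∧ ∃ (Y : E → E) (K L : NNReal),
      LipschitzWith K Y ∧ (∀ u, ‖Y u‖ ≤ L) ∧ EqOn Y X (Metric.cthickening r Γ) := by
  have : ProperSpace E := FiniteDimensional.proper_real E
  obtain ⟨R, hR, hRV⟩ := hΓ.exists_cthickening_subset_open hV hΓV
  have hRc : IsCompact (Metric.cthickening R Γ) := hΓ.cthickening
  have hd : Disjoint (Metric.thickening R Γ)ᶜ (Metric.cthickening (R / 2) Γ) :=
    disjoint_compl_left_iff_subset.2
      (Metric.cthickening_subset_thickening' hR (by linarith) Γ)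
  obtain ⟨f, hf0, hf1, -⟩ := exists_contMDiffMap_zero_one_of_isClosed (n := 1)
    (modelWithCornersSelf ℝ E) Metric.isOpen_thickening.isClosed_compl
    Metric.isClosed_cthickening hd
  have hf : ContDiff ℝ 1 f := f.contMDiff.contDiff
  have hsupp : tsupport f ⊆ Metric.cthickening R Γ := by
    refine closure_minimal (fun u hu => ?_) Metric.isClosed_cthickening
    by_contra hu'
    exact hu (hf0 fun h => hu' (Metric.thickening_subset_cthickening _ _ h))
  have hsupp' : tsupport (fun u => f u • X u) ⊆ Metric.cthickening R Γ :=
    (tsupport_smul_subset_left _ _).trans hsupp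
  -- The cutoff `f` is 1 on the R/2-neighbourhood and supported inside `V`, so `f • X` is C¹
  -- everywhere whatever `X` does outside `V`; compact support then gives both bounds.
  have hY : ContDiff ℝ 1 fun u => f u • X u := by
    refine contDiff_iff_contDiffAt.2 fun u => ?_
    by_cases hu : u ∈ tsupport fun u => f u • X u
    · exact hf.contDiffAt.smul (hX.contDiffAt (hV.mem_nhds (hRV (hsupp' hu))))
    · exact contDiffAt_const.congr_of_eventuallyEq (notMem_tsupport_iff_eventuallyEq.1 hu)
  have hYc : HasCompactSupport fun u => f u • X u :=
    HasCompactSupport.of_support_subset_isCompact hRc ((subset_tsupport _).trans hsupp')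
  obtain ⟨K, hK⟩ := hY.lipschitzWith_of_hasCompactSupport hYc one_ne_zero
  obtain ⟨L, hL⟩ := hYc.exists_bound_of_continuous hY.continuous
  refine ⟨R / 2, half_pos hR, (Metric.cthickening_mono (by linarith) _).trans hRV,
    _, K, L.toNNReal, hK, fun u => (hL u).trans (Real.le_coe_toNNReal L), fun u hu => ?_⟩
  simp [hf1 hu]

/-- A continuous function that starts below `ε`, and is below `ε` at each time up to which it has
been at most `ε`, stays below `ε`. -/
theorem ContinuousOn.lt_of_forall_le_imp_lt {f : ℝ → ℝ} {ε : ℝ} (hf : ContinuousOn f (Ici 0))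
    (h0 : f 0 < ε) (h : ∀ t ≥ 0, (∀ s ∈ Icc 0 t, f s ≤ ε) → f t < ε) : ∀ t ≥ 0, f t < ε := by
  intro t ht
  by_contra! hft
  have hfc : ContinuousOn f (Icc 0 t) := hf.mono Icc_subset_Ici_self
  have hS : IsCompact (Icc 0 t ∩ f ⁻¹' {ε}) :=
    isCompact_Icc.of_isClosed_subset (hfc.preimage_isClosed_of_isClosed isClosed_Icc
      isClosed_singleton) inter_subset_left
  obtain ⟨s₀, hs₀, hfs₀⟩ := intermediate_value_Icc ht hfc ⟨h0.le, hft⟩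
  -- `s` is the first time at which `f` equals `ε`; exceeding `ε` at some `r ≤ s` would force an
  -- earlier crossing.
  obtain ⟨s, ⟨hs, hfs⟩, hmin⟩ := hS.exists_isLeast ⟨s₀, hs₀, hfs₀⟩
  refine (h s hs.1 fun r hr => ?_).ne hfs
  by_contra! hfr
  obtain ⟨q, hq, hfq⟩ := intermediate_value_Icc hr.1
    (hfc.mono (Icc_subset_Icc_right (hr.2.trans hs.2))) ⟨h0.le, hfr.le⟩
  have : s ≤ q := hmin ⟨⟨hq.1, hq.2.trans (hr.2.trans hs.2)⟩, hfq⟩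
  have hrs : r = s := le_antisymm hr.2 (this.trans hq.2)
  rw [hrs] at hfr
  exact hfr.ne' hfs

/-- Gronwall's inequality for two integral curves, shifted in time. -/
theorem LipschitzWith.dist_integralCurve_add_le {Y : E → E} {K : NNReal} (hY : LipschitzWith K Y)
    {x γ : ℝ → E} (hx : IsIntegralCurveOn x (fun _ => Y) (Ici 0))
    (hγ : IsIntegralCurve γ (fun _ => Y)) {t₀ : ℝ} (ht₀ : 0 ≤ t₀) (τ : ℝ) {s : ℝ} (hs : 0 ≤ s) :
    dist (x (t₀ + s)) (γ (τ + s)) ≤ dist (x t₀) (γ τ) * Real.exp (K * s) := by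
  have hxd : ∀ r ≥ 0, HasDerivWithinAt (fun r => x (t₀ + r)) (Y (x (t₀ + r))) (Ici r) r := by
    intro r hr
    have h1 : HasDerivWithinAt x (Y (x (t₀ + r))) (Ici 0) (t₀ + r) :=
      hx _ (by simp only [mem_Ici]; linarith)
    have h2 : HasDerivWithinAt (fun r => t₀ + r) 1 (Ici r) r :=
      ((hasDerivAt_id r).const_add t₀).hasDerivWithinAt
    simpa using! h1.scomp r h2 fun q hq => by
      simp only [mem_Ici] at hq ⊢
      linarith
  have hγd : ∀ r, HasDerivAt (fun r => γ (τ + r)) (Y (γ (τ + r))) r := by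
    intro r
    simpa using! (hγ (τ + r)).scomp r ((hasDerivAt_id r).const_add τ)
  have := dist_le_of_trajectories_ODE (v := fun _ => Y) (K := K) (a := 0) (b := s)
    (f := fun r => x (t₀ + r)) (g := fun r => γ (τ + r)) (δ := dist (x t₀) (γ τ))
    (fun _ => hY) ?_ (fun r hr => hxd r hr.1)
    (fun r _ => (hγd r).continuousAt.continuousWithinAt) (fun r _ => (hγd r).hasDerivWithinAt)
    (by simp) s ⟨hs, le_rfl⟩
  · simpa using this
  · refine (hx.continuousOn.comp (t := Ici 0) (by fun_prop) fun r hr => ?_)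
    simp only [mem_Ici]
    linarith [hr.1]

/-- An integral curve that approaches a periodic orbit exponentially fast has an asymptotic
phase. -/
theorem exists_asymptotic_phase [CompleteSpace E] {Y : E → E} {K : NNReal} (hY : LipschitzWith K Y)
    {x γ : ℝ → E} {T A k : ℝ} (hx : IsIntegralCurveOn x (fun _ => Y) (Ici 0))
    (hγ : IsIntegralCurve γ (fun _ => Y)) (hT : 0 < T) (hper : Function.Periodic γ T) (hk : 0 < k)
    (hdist : ∀ t ≥ 0, Metric.infDist (x t) (γ '' Icc 0 T) ≤ A * Real.exp (-k * t)) :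
    ∃ θ : ℝ, Tendsto (fun t => ‖x t - γ (t + θ)‖) atTop (𝓝 0) := by
  have hγc : Continuous γ := hγ.continuous
  have hΓ : IsCompact (γ '' Icc 0 T) := isCompact_Icc.image hγc
  have hΓne : (γ '' Icc 0 T).Nonempty := ⟨_, mem_image_of_mem γ ⟨le_rfl, hT.le⟩⟩
  have hnT : ∀ n : ℕ, (0 : ℝ) ≤ n * T := fun n => by positivity
  -- After one period γ returns to the point of the orbit nearest to `x (n * T)`, so consecutive
  -- samples are both close to that same point and their distances decay geometrically.
  have hstep : ∀ n : ℕ, dist (x (n * T)) (x ((n + 1 : ℕ) * T)) ≤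
      A * (1 + Real.exp (K * T)) * Real.exp (-k * T) ^ n := by
    intro n
    obtain ⟨_, ⟨τ, -, rfl⟩, hτ⟩ := hΓ.exists_infDist_eq_dist hΓne (x (n * T))
    have h1 : dist (x (n * T)) (γ τ) ≤ A * Real.exp (-k * T) ^ n := by
      rw [← hτ, ← Real.exp_nat_mul]
      convert hdist _ (hnT n) using 3
      ring
    have h2 := hY.dist_integralCurve_add_le hx hγ (hnT n) τ hT.le
    rw [hper τ] at h2
    have h3 : ((n + 1 : ℕ) : ℝ) * T = n * T + T := by push_cast; ring
    rw [h3]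
    calc dist (x (n * T)) (x (n * T + T))
        ≤ dist (x (n * T)) (γ τ) + dist (x (n * T + T)) (γ τ) := dist_triangle_right _ _ _
      _ ≤ dist (x (n * T)) (γ τ) + dist (x (n * T)) (γ τ) * Real.exp (K * T) := by gcongr
      _ = dist (x (n * T)) (γ τ) * (1 + Real.exp (K * T)) := by ring
      _ ≤ A * Real.exp (-k * T) ^ n * (1 + Real.exp (K * T)) := by gcongr
      _ = _ := by ring
  have hr : Real.exp (-k * T) < 1 := Real.exp_lt_one_iff.2 (by nlinarith)
  obtain ⟨q, hq⟩ := cauchySeq_tendsto_of_complete (cauchySeq_of_le_geometric _ _ hr hstep)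
  have hqΓ : q ∈ γ '' Icc 0 T := by
    rw [hΓ.isClosed.mem_iff_infDist_zero hΓne]
    refine tendsto_nhds_unique ((Metric.continuous_infDist_pt _).continuousAt.tendsto.comp hq) ?_
    refine squeeze_zero (fun n => Metric.infDist_nonneg) (fun n => hdist _ (hnT n)) ?_
    have : Tendsto (fun n : ℕ => A * Real.exp (-k * T) ^ n) atTop (𝓝 (A * 0)) :=
      (tendsto_pow_atTop_nhds_zero_of_lt_one (Real.exp_pos _).le hr).const_mul A
    rw [mul_zero] at this
    refine this.congr fun n => ?_
    rw [← Real.exp_nat_mul]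
    ring_nf
  obtain ⟨θ, -, rfl⟩ := hqΓ
  refine ⟨θ, ?_⟩
  have hfloor : Tendsto (fun t : ℝ => ⌊t / T⌋₊) atTop atTop :=
    tendsto_nat_floor_atTop.comp (tendsto_id.atTop_div_const hT)
  -- Between samples less than one period elapses, so Gronwall costs at most the fixed factor `exp
  -- (K * T)`.
  have hlim : Tendsto (fun t : ℝ => dist (x (⌊t / T⌋₊ * T)) (γ θ) * Real.exp (K * T)) atTop
      (𝓝 0) := by
    simpa using ((tendsto_iff_dist_tendsto_zero.1 hq).comp hfloor).mul_const (Real.exp (K * T))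
  refine squeeze_zero' (Eventually.of_forall fun t => norm_nonneg _) ?_ hlim
  filter_upwards [eventually_ge_atTop 0] with t ht
  set n := ⌊t / T⌋₊
  have hn1 : n * T ≤ t := (le_div_iff₀ hT).1 (Nat.floor_le (by positivity))
  have hn2 : t < (n + 1) * T := (div_lt_iff₀ hT).1 (Nat.lt_floor_add_one _)
  have h1 := hY.dist_integralCurve_add_le hx hγ (hnT n) θ (s := t - n * T) (by linarith)
  have h2 : γ (t + θ) = γ (θ + (t - n * T)) := by
    rw [← hper.nat_mul n (θ + (t - n * T))]
    ring_nf
  rw [add_sub_cancel, ← h2, dist_eq_norm] at h1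
  refine h1.trans ?_
  gcongr
  linarith

end Flows

/-! ### Distance to a curve controlled by the defining functions. -/

/-- On a compact set, local linear bounds combine into a uniform one. -/
theorem IsCompact.exists_eventually_nhdsSet_le_mul {E : Type*} [TopologicalSpace E] {Γ : Set E}
    (hΓ : IsCompact Γ) {f g : E → ℝ}
    (hg : ∀ x, 0 ≤ g x) (h : ∀ p ∈ Γ, ∃ K : ℝ, 0 ≤ K ∧ ∀ᶠ x in 𝓝 p, f x ≤ K * g x) :
    ∃ K : ℝ, 0 ≤ K ∧ ∀ᶠ x in 𝓝ˢ Γ, f x ≤ K * g x := by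
  refine hΓ.induction_on (p := fun s => ∃ K : ℝ, 0 ≤ K ∧ ∀ᶠ x in 𝓝ˢ s, f x ≤ K * g x)
    ⟨0, le_rfl, by simp⟩ ?_ ?_ ?_
  · rintro s t hst ⟨K, hK, ht⟩
    exact ⟨K, hK, ht.filter_mono (nhdsSet_mono hst)⟩
  · rintro s t ⟨K, hK, hs⟩ ⟨L, hL, ht⟩
    refine ⟨max K L, le_max_of_le_left hK, ?_⟩
    rw [nhdsSet_union, eventually_sup]
    refine ⟨hs.mono fun x hx => hx.trans ?_, ht.mono fun x hx => hx.trans ?_⟩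
    · exact mul_le_mul_of_nonneg_right (le_max_left _ _) (hg x)
    · exact mul_le_mul_of_nonneg_right (le_max_right _ _) (hg x)
  · intro p hp
    obtain ⟨K, hK, hp⟩ := h p hp
    obtain ⟨t, ht, hto, hpt⟩ := eventually_nhds_iff.1 hp
    refine ⟨t, mem_nhdsWithin_of_mem_nhds (hto.mem_nhds hpt), K, hK, ?_⟩
    exact (hto.mem_nhdsSet.2 subset_rfl : t ∈ 𝓝ˢ t) |> fun h => eventually_of_mem h ht

section Transversality

variable {E F : Type*} [NormedAddCommGroup E] [InnerProductSpace ℝ E] [FiniteDimensional ℝ E]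
  [NormedAddCommGroup F] [NormedSpace ℝ F]

/-- Near a point of a curve in a level set of `f`, the distance to the curve is controlled by `f`,
if the derivative of `f` is injective on the orthogonal complement of the velocity. -/
theorem eventually_infDist_range_le_of_hasStrictFDerivAt {f : E → F} {f' : E →L[ℝ] F} {γ : ℝ → E}
    {v : E} {t₀ : ℝ} {y : F} (hf : HasStrictFDerivAt f f' (γ t₀)) (hγ : HasStrictDerivAt γ v t₀)
    (hv : v ≠ 0) (hy : ∀ t, f (γ t) = y) (hinj : ∀ w, f' w = 0 → inner ℝ v w = 0 → w = 0) :
    ∃ K : ℝ, 0 ≤ K ∧ ∀ᶠ x in 𝓝 (γ t₀), Metric.infDist x (range γ) ≤ K * ‖f x - y‖ := by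
  have := FiniteDimensional.complete ℝ E
  -- Joined with the component along `v`, the derivative becomes injective, hence bounded below in
  -- finite dimension.
  obtain ⟨K, hK, hA⟩ := (f'.prod (innerSL ℝ v)).toLinearMap.exists_antilipschitzWith <| by
    refine LinearMap.ker_eq_bot'.2 fun w hw => ?_
    have hw' : (f' w, inner ℝ v w) = ((0 : F), (0 : ℝ)) := hw
    exact hinj w (congrArg Prod.fst hw') (congrArg Prod.snd hw')
  have hK' : (0 : ℝ) < K := hK
  -- With `c = (2 * K)⁻¹` the linearization error contributes at most half of `‖x - γ t‖`, which is
  -- absorbed on the left.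
  obtain ⟨s, hs, hfs⟩ := hf.approximates_deriv_on_nhds (c := (2 * K)⁻¹) (Or.inr (by positivity))
  have hφ : HasStrictDerivAt (fun t => inner ℝ v (γ t)) (inner ℝ v v) t₀ :=
    (innerSL ℝ v).hasStrictFDerivAt.comp_hasStrictDerivAt t₀ hγ
  -- `⟪v, γ t⟫` has derivative `‖v‖² ≠ 0`, so it is open at `t₀`: every `x` near `γ t₀` has a curve
  -- point `γ t` with `x - γ t` orthogonal to `v`.
  have himg : (fun t => inner ℝ v (γ t)) '' (γ ⁻¹' s) ∈ 𝓝 (inner ℝ v (γ t₀)) := by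
    rw [← hφ.map_nhds_eq (inner_self_ne_zero.2 hv)]
    exact image_mem_map (hγ.hasDerivAt.continuousAt.preimage_mem_nhds hs)
  refine ⟨2 * K, by positivity, ?_⟩
  filter_upwards [hs, (innerSL ℝ v).continuous.continuousAt.preimage_mem_nhds himg]
    with x hx ⟨t, ht, hxt⟩
  have hxt' : inner ℝ v (γ t) = inner ℝ v x := hxt
  have h1 : ‖x - γ t‖ ≤ K * ‖f' (x - γ t)‖ := by
    have := hA.le_mul_dist x (γ t)
    simpa [dist_eq_norm, ← map_sub, Prod.norm_def, ← inner_sub_right, hxt'] using! this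
  have h2 : ‖f x - f (γ t) - f' (x - γ t)‖ ≤ (2 * K : ℝ)⁻¹ * ‖x - γ t‖ := by
    simpa using! hfs x hx (γ t) ht
  have h3 : ‖f' (x - γ t)‖ ≤ ‖f x - y‖ + (2 * K : ℝ)⁻¹ * ‖x - γ t‖ := by
    rw [hy, norm_sub_rev] at h2
    have := norm_sub_norm_le (f' (x - γ t)) (f x - y)
    linarith
  have h4 : K * ((2 * K : ℝ)⁻¹ * ‖x - γ t‖) = ‖x - γ t‖ / 2 := by field_simp
  have h5 : ‖x - γ t‖ ≤ 2 * K * ‖f x - y‖ := by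
    have := mul_le_mul_of_nonneg_left h3 hK'.le
    rw [mul_add, h4] at this
    linarith
  calc Metric.infDist x (range γ) ≤ dist x (γ t) := Metric.infDist_le_dist_of_mem ⟨t, rfl⟩
    _ ≤ _ := by rwa [dist_eq_norm]

end Transversality

/-! ### Cross product identities and smoothness. -/

namespace E3

theorem inner_eq (a b : E3) : inner ℝ a b = a 0 * b 0 + a 1 * b 1 + a 2 * b 2 := by
  simp [PiLp.inner_apply, Fin.sum_univ_three]
  ring

@[simp] theorem cross_apply_zero (a b : E3) : cross a b 0 = a 1 * b 2 - a 2 * b 1 := rfl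
@[simp] theorem cross_apply_one (a b : E3) : cross a b 1 = a 2 * b 0 - a 0 * b 2 := rfl
@[simp] theorem cross_apply_two (a b : E3) : cross a b 2 = a 0 * b 1 - a 1 * b 0 := rfl

theorem inner_cross_self_left (a b : E3) : inner ℝ a (cross a b) = 0 := by
  simp only [inner_eq, cross_apply_zero, cross_apply_one, cross_apply_two]
  ring

theorem inner_cross_self_right (a b : E3) : inner ℝ b (cross a b) = 0 := by
  simp only [inner_eq, cross_apply_zero, cross_apply_one, cross_apply_two]
  ring

theorem inner_left_cross_cross (a b : E3) :
    inner ℝ a (cross b (cross a b)) = ‖cross a b‖ ^ 2 := by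
  rw [← real_inner_self_eq_norm_sq]
  simp only [inner_eq, cross_apply_zero, cross_apply_one, cross_apply_two]
  ring

theorem inner_right_cross_cross (a b : E3) :
    inner ℝ b (cross a (cross a b)) = -‖cross a b‖ ^ 2 := by
  rw [← real_inner_self_eq_norm_sq]
  simp only [inner_eq, cross_apply_zero, cross_apply_one, cross_apply_two]
  ring

/-- Lagrange's identity. With `n = a × b` and the triple product expansion it forces `w = 0` once
`w` is orthogonal to `a`, `b` and `a × b ≠ 0`. -/
theorem norm_sq_mul_norm_sq (n w : E3) :
    ‖n‖ ^ 2 * ‖w‖ ^ 2 = ‖cross n w‖ ^ 2 + (inner ℝ n w) ^ 2 := by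
  simp only [← real_inner_self_eq_norm_sq, inner_eq, cross_apply_zero, cross_apply_one,
    cross_apply_two]
  ring

theorem cross_cross_left (a b w : E3) :
    cross (cross a b) w = inner ℝ a w • b - inner ℝ b w • a := by
  ext i
  fin_cases i <;> simp [inner_eq] <;> ring

theorem cross_ne_zero {a b : E3} (h : LinearIndependent ℝ ![a, b]) : cross a b ≠ 0 := by
  have h' : LinearIndependent ℝ ![WithLp.ofLp a, WithLp.ofLp b] := by
    have := h.map' (WithLp.linearEquiv 2 ℝ (Fin 3 → ℝ)).toLinearMap (LinearEquiv.ker _)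
    have hcomp : (WithLp.linearEquiv 2 ℝ (Fin 3 → ℝ)).toLinearMap ∘ ![a, b] =
        ![WithLp.ofLp a, WithLp.ofLp b] := by
      ext i j
      fin_cases i <;> rfl
    rwa [hcomp] at this
  intro h0
  exact crossProduct_ne_zero_iff_linearIndependent.2 h' (congrArg WithLp.ofLp h0)

/-- A vector orthogonal to `a`, `b` and `a × b ≠ 0` vanishes. -/
theorem eq_zero_of_inner_eq_zero {a b w : E3} (hn : cross a b ≠ 0) (ha : inner ℝ a w = 0)
    (hb : inner ℝ b w = 0) (hw : inner ℝ (cross a b) w = 0) : w = 0 := by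
  have h := norm_sq_mul_norm_sq (cross a b) w
  rw [cross_cross_left, ha, hb, hw] at h
  simpa [hn] using h

theorem _root_.ContDiffOn.cross {k : WithTop ℕ∞} {f g : E3 → E3} {s : Set E3}
    (hf : ContDiffOn ℝ k f s) (hg : ContDiffOn ℝ k g s) :
    ContDiffOn ℝ k (fun u => cross (f u) (g u)) s := by
  have hf' := fun i => (contDiffOn_euclidean.1 hf) i
  have hg' := fun i => (contDiffOn_euclidean.1 hg) i
  refine contDiffOn_euclidean.2 fun i => ?_
  fin_cases i
  · exact ((hf' 1).mul (hg' 2)).sub ((hf' 2).mul (hg' 1))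
  · exact ((hf' 2).mul (hg' 0)).sub ((hf' 0).mul (hg' 2))
  · exact ((hf' 0).mul (hg' 1)).sub ((hf' 1).mul (hg' 0))

theorem _root_.ContDiffOn.gradient_of_isOpen {f : E3 → ℝ} {U : Set E3} (hU : IsOpen U)
    (hf : ContDiffOn ℝ ∞ f U) : ContDiffOn ℝ ∞ (gradient f) U :=
  (InnerProductSpace.toDual ℝ E3).symm.contDiff.comp_contDiffOn (hf.fderiv_of_isOpen hU (by simp))

end E3

/-! ### From a Lyapunov function to orbital stability with phase. -/

section Lyapunov

variable {E : Type*} [NormedAddCommGroup E] [NormedSpace ℝ E]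

theorem Metric.mem_cthickening_iff_infDist_le {E : Type*} [PseudoMetricSpace E] {Γ : Set E}
    (hΓ : Γ.Nonempty) {r : ℝ} (hr : 0 ≤ r) {u : E} :
    u ∈ Metric.cthickening r Γ ↔ Metric.infDist u Γ ≤ r := by
  rw [Metric.mem_cthickening_iff, Metric.infDist,
    ENNReal.le_ofReal_iff_toReal_le (Metric.infEDist_ne_top hΓ) hr]

theorem IsPeriodicOrbit.mem_orbit {X : E → E} {D : Set E} {γ : ℝ → E} {T : ℝ} {Γ : Set E}
    (hΓ : IsPeriodicOrbit X D γ T Γ) (t : ℝ) : γ t ∈ Γ := by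
  obtain ⟨s, hs, hst⟩ := hΓ.periodic.exists_mem_Ico₀ hΓ.period_pos t
  rw [hst, hΓ.orbit_eq]
  exact mem_image_of_mem γ (Ico_subset_Icc_self hs)

theorem IsPeriodicOrbit.range_eq {X : E → E} {D : Set E} {γ : ℝ → E} {T : ℝ} {Γ : Set E}
    (hΓ : IsPeriodicOrbit X D γ T Γ) : range γ = Γ := by
  refine (range_subset_iff.2 hΓ.mem_orbit).antisymm ?_
  rw [hΓ.orbit_eq]
  exact image_subset_range _ _

theorem IsPeriodicOrbit.isIntegralCurve {X : E → E} {D : Set E} {γ : ℝ → E} {T : ℝ} {Γ : Set E}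
    (hΓ : IsPeriodicOrbit X D γ T Γ) : IsIntegralCurve γ (fun _ => X) :=
  isIntegralCurveOn_univ.1 hΓ.solution.2

theorem IsPeriodicOrbit.isCompact {X : E → E} {D : Set E} {γ : ℝ → E} {T : ℝ} {Γ : Set E}
    (hΓ : IsPeriodicOrbit X D γ T Γ) : IsCompact Γ := by
  rw [hΓ.orbit_eq]
  exact isCompact_Icc.image hΓ.isIntegralCurve.continuous

theorem IsPeriodicOrbit.nonempty {X : E → E} {D : Set E} {γ : ℝ → E} {T : ℝ} {Γ : Set E}
    (hΓ : IsPeriodicOrbit X D γ T Γ) : Γ.Nonempty :=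
  ⟨γ 0, hΓ.mem_orbit 0⟩

/-- A vector field does not vanish along a periodic orbit near which it is locally Lipschitz. -/
theorem IsPeriodicOrbit.ne_zero {X Y : E → E} {D : Set E} {γ : ℝ → E} {T : ℝ} {Γ : Set E}
    {K : NNReal} (hΓ : IsPeriodicOrbit X D γ T Γ) (hY : LipschitzWith K Y) (hYX : EqOn Y X Γ)
    (t₀ : ℝ) : X (γ t₀) ≠ 0 := by
  intro h0
  -- A zero on the orbit would make the constant curve a second solution; uniqueness is applied to
  -- the globally Lipschitz `Y`.
  have heq : γ = fun _ => γ t₀ := by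
    refine ODE_solution_unique_univ (v := fun _ => Y) (s := fun _ => univ) (t₀ := t₀) (K := K)
      (fun _ => hY.lipschitzOnWith) (fun t => ⟨?_, trivial⟩) (fun t => ⟨?_, trivial⟩) rfl
    · rw [hYX (hΓ.mem_orbit t)]
      exact hΓ.isIntegralCurve t
    · rw [hYX (hΓ.mem_orbit t₀), h0]
      exact hasDerivAt_const _ _
  obtain ⟨t, ht⟩ := hΓ.nonconstant
  exact ht ((congrFun heq t).trans (congrFun heq 0).symm)

/-- A periodic orbit is orbitally phase asymptotically stable if there is a function `G ≥ 0` that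
vanishes on it, controls the squared distance to it, and decays exponentially along the solutions
near it. -/
theorem IsPeriodicOrbit.orbitallyPhaseAsymptoticallyStable [CompleteSpace E] {X Y : E → E}
    {V : Set E} {γ : ℝ → E} {T : ℝ} {Γ : Set E} (hΓ : IsPeriodicOrbit X V γ T Γ)
    {r : ℝ} (hr : 0 < r) (hrV : Metric.cthickening r Γ ⊆ V)
    {K L : NNReal} (hY : LipschitzWith K Y) (hL : ∀ u, ‖Y u‖ ≤ L)
    (hYX : EqOn Y X (Metric.cthickening r Γ))
    {G : E → ℝ} (hGc : ContinuousOn G (Metric.cthickening r Γ)) (hG : ∀ u, 0 ≤ G u)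
    (hGΓ : ∀ u ∈ Γ, G u = 0) {M κ : ℝ} (hκ : 0 < κ) (hM : 0 ≤ M)
    (hdist : ∀ u ∈ Metric.cthickening r Γ, Metric.infDist u Γ ≤ M * √(G u))
    (hdecay : ∀ (x : ℝ → E) (t : ℝ), 0 ≤ t → (∀ s ∈ Icc 0 t, x s ∈ Metric.cthickening r Γ) →
      IsIntegralCurveOn x (fun _ => X) (Icc 0 t) → G (x t) ≤ G (x 0) * Real.exp (-κ * t)) :
    OrbitallyPhaseAsymptoticallyStable X V γ Γ := by
  have hne := hΓ.nonempty
  have hmem : ∀ {u : E}, u ∈ Metric.cthickening r Γ ↔ Metric.infDist u Γ ≤ r := fun {u} =>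
    Metric.mem_cthickening_iff_infDist_le hne hr.le
  have hΓN : Γ ⊆ Metric.cthickening r Γ := Metric.self_subset_cthickening Γ
  -- The curve need only solve `X` while it stays in the neighbourhood, so the same trap serves
  -- integral curves of `Y` (for existence) and arbitrary solutions of `X`.
  have htrap : ∀ ε > 0, ε ≤ r → ∃ δ > 0, ∀ x : ℝ → E, Metric.infDist (x 0) Γ < δ →
      ContinuousOn x (Ici 0) →
      (∀ t ≥ 0, (∀ s ∈ Icc 0 t, x s ∈ Metric.cthickening r Γ) →
        IsIntegralCurveOn x (fun _ => X) (Icc 0 t)) →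
      ∀ t ≥ 0, Metric.infDist (x t) Γ < ε := by
    intro ε hε hεr
    have hev : ∀ᶠ u in 𝓝ˢ Γ, M * √(G u) < ε := by
      refine eventually_nhdsSet_iff_forall.2 fun p hp => ?_
      have hcp : ContinuousAt G p := hGc.continuousAt <|
        mem_of_superset (Metric.isOpen_thickening.mem_nhds (Metric.self_subset_thickening hr Γ hp))
          (Metric.thickening_subset_cthickening r Γ)
      have hc : ContinuousAt (fun u => M * √(G u)) p := hcp.sqrt.const_mul M
      refine hc.eventually_lt_const ?_
      simpa [hGΓ p hp] using hε
    obtain ⟨δ, hδ, hδs⟩ := (Metric.hasBasis_nhdsSet_thickening hΓ.isCompact).eventually_iff.1 hev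
    refine ⟨min δ ε, lt_min hδ hε, fun x hx0 hxc hxX => ?_⟩
    refine ContinuousOn.lt_of_forall_le_imp_lt (f := fun t => Metric.infDist (x t) Γ)
      ((Metric.continuous_infDist_pt Γ).comp_continuousOn hxc) (hx0.trans_le (min_le_right _ _))
      fun t ht hs => ?_
    have hsN : ∀ s ∈ Icc 0 t, x s ∈ Metric.cthickening r Γ := fun s h =>
      hmem.2 ((hs s h).trans hεr)
    have hGt : G (x t) ≤ G (x 0) := by
      refine (hdecay x t ht hsN (hxX t ht hsN)).trans
        (mul_le_of_le_one_right (hG _) (Real.exp_le_one_iff.2 ?_))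
      nlinarith
    calc Metric.infDist (x t) Γ ≤ M * √(G (x t)) := hdist _ (hsN t ⟨ht, le_rfl⟩)
      _ ≤ M * √(G (x 0)) := by gcongr
      _ < ε := hδs ((Metric.mem_thickening_iff_infDist_lt hne).2 (hx0.trans_le (min_le_left _ _)))
  have hmain : ∀ ε > 0, ∃ δ > 0, ∀ x₀ ∈ V, Metric.infDist x₀ Γ < δ →
      ForwardSolutionSatisfies X V x₀ fun x => (∀ t ≥ 0, Metric.infDist (x t) Γ < ε) ∧
        ∀ t ≥ 0, x t ∈ Metric.cthickening r Γ := by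
    intro ε hε
    obtain ⟨δ, hδ, hδx⟩ := htrap (min ε r) (lt_min hε hr) (min_le_right _ _)
    refine ⟨δ, hδ, fun x₀ _ hx₀ => ⟨?_, fun x hx => ?_⟩⟩
    · obtain ⟨x, hx0, hx⟩ := hY.exists_isIntegralCurve hL x₀
      have hxN : ∀ t ≥ 0, x t ∈ Metric.cthickening r Γ := fun t ht =>
        hmem.2 (((hδx x (hx0.symm ▸ hx₀) hx.continuous.continuousOn fun t _ hs s h => by
          beta_reduce
          rw [← hYX (hs s h)]
          exact (hx s).hasDerivWithinAt) t ht).le.trans (min_le_right _ _))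
      refine ⟨x, hx0, fun t ht => hrV (hxN t ht), fun t ht => ?_⟩
      beta_reduce
      rw [← hYX (hxN t ht)]
      exact (hx t).hasDerivWithinAt
    · have := hδx x (hx.1.symm ▸ hx₀) hx.2.2.continuousOn fun t _ _ =>
        hx.2.2.mono Icc_subset_Ici_self
      exact ⟨fun t ht => (this t ht).trans_le (min_le_left _ _),
        fun t ht => hmem.2 ((this t ht).le.trans (min_le_right _ _))⟩
  have hexp : ∀ x : ℝ → E, IsIntegralCurveOn x (fun _ => X) (Ici 0) →
      (∀ t ≥ 0, x t ∈ Metric.cthickening r Γ) → ∀ t ≥ 0,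
      Metric.infDist (x t) Γ ≤ M * √(G (x 0)) * Real.exp (-(κ / 2) * t) := by
    intro x hx hxN t ht
    have hd := hdecay x t ht (fun s hs => hxN s hs.1) (hx.mono Icc_subset_Ici_self)
    -- The distance is bounded by the square root of `G`, hence decays at half the rate.
    have hsq : Real.exp (-κ * t) = Real.exp (-(κ / 2) * t) ^ 2 := by
      rw [← Real.exp_nat_mul]
      congr 1
      push_cast
      ring
    calc Metric.infDist (x t) Γ ≤ M * √(G (x t)) := hdist _ (hxN t ht)
      _ ≤ M * √(G (x 0) * Real.exp (-(κ / 2) * t) ^ 2) := by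
          rw [← hsq]
          gcongr
      _ = _ := by
          rw [Real.sqrt_mul (hG _), Real.sqrt_sq (Real.exp_pos _).le, mul_assoc]
  obtain ⟨δ, hδ, hδx⟩ := hmain 1 one_pos
  refine ⟨⟨fun ε hε => ?_, δ, hδ, fun x₀ hx₀V hx₀ => ?_⟩, δ, hδ, fun x₀ hx₀V hx₀ => ?_⟩
  · obtain ⟨δ, hδ, hδx⟩ := hmain ε hε
    refine ⟨δ, hδ, fun x₀ hx₀V hx₀ => ⟨(hδx x₀ hx₀V hx₀).1, fun x hx t ht => ?_⟩⟩
    exact ((hδx x₀ hx₀V hx₀).2 x hx).1 t ht.le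
  · refine ⟨(hδx x₀ hx₀V hx₀).1, fun x hx => ?_⟩
    refine squeeze_zero' (Eventually.of_forall fun t => Metric.infDist_nonneg) ?_ ?_
      (g := fun t => M * √(G (x 0)) * Real.exp (-(κ / 2) * t))
    · filter_upwards [eventually_ge_atTop 0] with t ht
      exact hexp x hx.2.2 ((hδx x₀ hx₀V hx₀).2 x hx).2 t ht
    · have h1 : Tendsto (fun t : ℝ => -(κ / 2) * t) atTop atBot :=
        tendsto_id.const_mul_atTop_of_neg (by linarith)
      simpa using (Real.tendsto_exp_atBot.comp h1).const_mul (M * √(G (x 0)))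
  · refine ⟨(hδx x₀ hx₀V hx₀).1, fun x hx => ?_⟩
    have hxN := ((hδx x₀ hx₀V hx₀).2 x hx).2
    refine exists_asymptotic_phase (k := κ / 2) hY (fun t ht => ?_) (fun t => ?_) hΓ.period_pos
      hΓ.periodic (half_pos hκ) (hΓ.orbit_eq ▸ hexp x hx.2.2 hxN)
    · beta_reduce
      rw [hYX (hxN t ht)]
      exact hx.2.2 t ht
    · beta_reduce
      rw [hYX (hΓN (hΓ.mem_orbit t))]
      exact hΓ.isIntegralCurve t

end Lyapunov

/-! ### Damping, transversality and nonconservation for the perturbed field. -/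

namespace E3

variable {U V : Set E3} {ν H C α β : E3 → ℝ} {h c : ℝ}

theorem perturbedField_of_level {u : E3} (hu : H u = h) (cu : C u = c) :
    perturbedField ν H C α β h c u = hamField ν H C u := by
  simp [perturbedField, hu, cu]

theorem inner_gradient_left_perturbedField (ν H C α β : E3 → ℝ) (h c : ℝ) (u : E3) :
    inner ℝ (gradient H u) (perturbedField ν H C α β h c u) =
      -(α u * ‖cross (gradient H u) (gradient C u)‖ ^ 2 * (H u - h)) := by
  simp only [perturbedField, hamField, inner_add_right, inner_sub_right, real_inner_smul_right,
    inner_cross_self_left, inner_left_cross_cross]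
  ring

theorem inner_gradient_right_perturbedField (ν H C α β : E3 → ℝ) (h c : ℝ) (u : E3) :
    inner ℝ (gradient C u) (perturbedField ν H C α β h c u) =
      -(β u * ‖cross (gradient H u) (gradient C u)‖ ^ 2 * (C u - c)) := by
  simp only [perturbedField, hamField, inner_add_right, inner_sub_right, real_inner_smul_right,
    inner_cross_self_left, inner_cross_self_right, inner_right_cross_cross]
  ring

theorem contDiffOn_perturbedField (hV : IsOpen V) (hν : ContDiffOn ℝ ∞ ν V)
    (hH : ContDiffOn ℝ ∞ H V) (hC : ContDiffOn ℝ ∞ C V) (hα : ContDiffOn ℝ ∞ α V)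
    (hβ : ContDiffOn ℝ ∞ β V) : ContDiffOn ℝ ∞ (perturbedField ν H C α β h c) V := by
  have a := hH.gradient_of_isOpen hV
  have b := hC.gradient_of_isOpen hV
  exact ((hν.smul (a.cross b)).sub
    ((hα.mul (hH.sub contDiffOn_const)).smul (b.cross (a.cross b)))).add
    ((hβ.mul (hC.sub contDiffOn_const)).smul (a.cross (a.cross b)))

theorem _root_.DifferentiableAt.comp_hasDerivWithinAt_gradient {f : E3 → ℝ} {x : ℝ → E3} {v : E3}
    {s : Set ℝ} {t : ℝ} (hf : DifferentiableAt ℝ f (x t)) (hx : HasDerivWithinAt x v s t) :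
    HasDerivWithinAt (fun t => f (x t)) (inner ℝ (gradient f (x t)) v) s t := by
  simpa using! hf.hasGradientAt.hasFDerivAt.comp_hasDerivWithinAt t hx

/-- `f` is not conserved near a stable periodic orbit in a level set of `f`, on which `f` is
regular, if the vector field is transverse to the other level sets. -/
theorem not_isConservedOn_of_orbitallyStable {X : E3 → E3} {W Γ : Set E3} {f : E3 → ℝ} {p : E3}
    (hst : OrbitallyStable X V Γ) (hΓ : IsCompact Γ) (hW : IsOpen W) (hΓW : Γ ⊆ W) (hWV : W ⊆ V)
    (hp : p ∈ Γ) (hf : ∀ u ∈ W, DifferentiableAt ℝ f u) (hgrad : gradient f p ≠ 0)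
    (hX : ∀ u ∈ W, f u ≠ f p → inner ℝ (gradient f u) (X u) ≠ 0) : ¬ IsConservedOn f X W := by
  intro hcons
  obtain ⟨ε, hε, hεW⟩ := hΓ.exists_thickening_subset_open hW hΓW
  obtain ⟨δ, hδ, hδx⟩ := hst ε hε
  -- A nonzero gradient prevents `f` from being locally constant, so points off its level exist
  -- arbitrarily close to `p`.
  have hfreq : ∃ᶠ u in 𝓝 p, f u ≠ f p := by
    intro hev
    refine hgrad ?_
    have hev' : f =ᶠ[𝓝 p] fun _ => f p := hev.mono fun u hu => not_not.1 hu
    rw [hev'.gradient_eq, gradient_fun_const]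
  have hnear : ∀ᶠ u in 𝓝 p, u ∈ W ∧ Metric.infDist u Γ < δ := by
    refine Filter.Eventually.and (hW.mem_nhds (hΓW hp)) ?_
    refine (Metric.continuous_infDist_pt Γ).continuousAt.eventually_lt_const ?_
    simpa [Metric.infDist_zero_of_mem hp] using hδ
  obtain ⟨u, hu, huW, huδ⟩ := (hfreq.and_eventually hnear).exists
  obtain ⟨⟨x, hx⟩, hall⟩ := hδx u (hWV huW) huδ
  have hxW : ∀ t ≥ 0, x t ∈ W := by
    intro t ht
    rcases ht.eq_or_lt with rfl | ht
    · rwa [hx.1]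
    · exact hεW ((Metric.mem_thickening_iff_infDist_lt ⟨p, hp⟩).2 (hall x hx t ht))
  have h0 : (0 : ℝ) ∈ Icc (0 : ℝ) 1 := ⟨le_rfl, zero_le_one⟩
  have hconst : ∀ t ∈ Icc (0 : ℝ) 1, f (x t) = f (x 0) := fun t ht =>
    (hcons x 0 t ht.1 ⟨fun s hs => hxW s hs.1, hx.2.2.mono Icc_subset_Ici_self⟩).symm
  have hd := (hf _ (hxW 0 le_rfl)).comp_hasDerivWithinAt_gradient
    ((hx.2.2 0 self_mem_Ici).mono (Icc_subset_Ici_self : Icc 0 1 ⊆ Ici (0 : ℝ)))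
  have hd0 : HasDerivWithinAt (fun t => f (x t)) 0 (Icc 0 1) 0 :=
    (hasDerivWithinAt_const 0 _ (f (x 0))).congr hconst rfl
  -- Conservation would make the one-sided derivative of `f` along the solution vanish at time 0,
  -- against `hX`.
  have heq := (uniqueDiffOn_Icc zero_lt_one 0 h0).eq_deriv _ hd hd0
  rw [hx.1] at heq
  exact hX u huW hu heq

/-- Along the perturbed system, `(H - h)² + (C - c)²` decays exponentially wherever the damping
coefficients are bounded below. -/
theorem level_gap_le_of_isIntegralCurveOn {N : Set E3} {κ : ℝ}
    (hH : ∀ u ∈ N, DifferentiableAt ℝ H u) (hC : ∀ u ∈ N, DifferentiableAt ℝ C u)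
    (hα : ∀ u ∈ N, κ ≤ α u * ‖cross (gradient H u) (gradient C u)‖ ^ 2)
    (hβ : ∀ u ∈ N, κ ≤ β u * ‖cross (gradient H u) (gradient C u)‖ ^ 2)
    {x : ℝ → E3} {t : ℝ} (ht : 0 ≤ t) (hxN : ∀ s ∈ Icc 0 t, x s ∈ N)
    (hx : IsIntegralCurveOn x (fun _ => perturbedField ν H C α β h c) (Icc 0 t)) :
    (H (x t) - h) ^ 2 + (C (x t) - c) ^ 2 ≤
      ((H (x 0) - h) ^ 2 + (C (x 0) - c) ^ 2) * Real.exp (-(2 * κ) * t) := by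
  -- The integrating factor `exp (2κs)` turns the exponential bound into monotonicity; its exponent
  -- is doubled because the gaps are squared.
  have hderiv : ∀ s ∈ Icc 0 t, HasDerivWithinAt
      (fun s => ((H (x s) - h) ^ 2 + (C (x s) - c) ^ 2) * Real.exp (2 * κ * s))
      (-2 * ((α (x s) * ‖cross (gradient H (x s)) (gradient C (x s))‖ ^ 2 - κ) * (H (x s) - h) ^ 2 +
        (β (x s) * ‖cross (gradient H (x s)) (gradient C (x s))‖ ^ 2 - κ) * (C (x s) - c) ^ 2) *
          Real.exp (2 * κ * s)) (Icc 0 t) s := by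
    intro s hs
    have h1 := (hH _ (hxN s hs)).comp_hasDerivWithinAt_gradient (hx s hs)
    have h2 := (hC _ (hxN s hs)).comp_hasDerivWithinAt_gradient (hx s hs)
    rw [inner_gradient_left_perturbedField] at h1
    rw [inner_gradient_right_perturbedField] at h2
    have h3 : HasDerivWithinAt (fun s => Real.exp (2 * κ * s)) (Real.exp (2 * κ * s) * (2 * κ * 1))
        (Icc 0 t) s := (((hasDerivAt_id s).const_mul (2 * κ)).exp).hasDerivWithinAt
    refine ((((h1.sub_const h).pow 2).add ((h2.sub_const c).pow 2)).mul h3).congr_deriv ?_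
    simp only [Pi.add_apply, Pi.pow_apply]
    push_cast
    ring
  have hanti := antitoneOn_of_hasDerivWithinAt_nonpos (convex_Icc 0 t)
    (fun s hs => (hderiv s hs).continuousWithinAt)
    (fun s hs => (hderiv s (interior_subset hs)).mono interior_subset) (fun s hs => by
      have hN := hxN s (interior_subset hs)
      have h1 := mul_nonneg (sub_nonneg.2 (hα _ hN)) (sq_nonneg (H (x s) - h))
      have h2 := mul_nonneg (sub_nonneg.2 (hβ _ hN)) (sq_nonneg (C (x s) - c))
      exact mul_nonpos_of_nonpos_of_nonneg (by linarith) (Real.exp_pos _).le)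
  have hle := hanti ⟨le_rfl, ht⟩ ⟨ht, le_rfl⟩ ht
  rw [neg_mul, Real.exp_neg, ← div_eq_mul_inv, le_div_iff₀ (Real.exp_pos _)]
  simpa using hle

/-- Near a periodic orbit of the perturbed system in a common level set, the distance to the orbit
is controlled by the values of `H` and `C`. -/
theorem eventually_infDist_le_level_gap {X : E3 → E3} {γ : ℝ → E3} {T : ℝ} {Γ : Set E3}
    (hΓ : IsPeriodicOrbit X V γ T Γ) (hΓX : ∀ u ∈ Γ, X u = hamField ν H C u)
    (hX0 : ∀ t, X (γ t) ≠ 0) (hXc : ∀ u ∈ Γ, ContinuousAt X u)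
    (hH : ∀ u ∈ Γ, ContDiffAt ℝ 1 H u) (hC : ∀ u ∈ Γ, ContDiffAt ℝ 1 C u)
    (hlevel : ∀ u ∈ Γ, H u = h ∧ C u = c) :
    ∃ M : ℝ, 0 ≤ M ∧ ∀ᶠ u in 𝓝ˢ Γ,
      Metric.infDist u Γ ≤ M * √((H u - h) ^ 2 + (C u - c) ^ 2) := by
  refine hΓ.isCompact.exists_eventually_nhdsSet_le_mul (fun u => Real.sqrt_nonneg _) fun p hp => ?_
  rw [← hΓ.range_eq] at hp
  obtain ⟨t, rfl⟩ := hp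
  have hp := hΓ.mem_orbit t
  have hv := hX0 t
  rw [hΓX _ hp] at hv
  -- The nonvanishing velocity is `ν • (∇H × ∇C)`, so both factors are nonzero.
  have hn : cross (gradient H (γ t)) (gradient C (γ t)) ≠ 0 := right_ne_zero_of_smul hv
  have hν : ν (γ t) ≠ 0 := left_ne_zero_of_smul hv
  have hγ : HasStrictDerivAt γ (X (γ t)) t :=
    hasStrictDerivAt_of_hasDerivAt_of_continuousAt (f' := fun s => X (γ s))
      (Eventually.of_forall hΓ.isIntegralCurve)
      ((hXc _ hp).comp hΓ.isIntegralCurve.continuous.continuousAt)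
  rw [hΓX _ hp] at hγ
  have hF := ((hH _ hp).hasStrictFDerivAt one_ne_zero).prodMk
    ((hC _ hp).hasStrictFDerivAt one_ne_zero)
  obtain ⟨M, hM, hev⟩ := eventually_infDist_range_le_of_hasStrictFDerivAt (y := (h, c)) hF hγ hv
    (fun s => Prod.ext (hlevel _ (hΓ.mem_orbit s)).1 (hlevel _ (hΓ.mem_orbit s)).2) <| by
      intro w hw hvw
      have hw1 : inner ℝ (gradient H (γ t)) w = 0 := by
        simpa [gradient] using! congrArg Prod.fst hw
      have hw2 : inner ℝ (gradient C (γ t)) w = 0 := by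
        simpa [gradient] using! congrArg Prod.snd hw
      rw [hamField, real_inner_smul_left] at hvw
      exact eq_zero_of_inner_eq_zero hn hw1 hw2 ((mul_eq_zero.1 hvw).resolve_left hν)
  rw [hΓ.range_eq] at hev
  refine ⟨M, hM, hev.mono fun u hu => hu.trans (mul_le_mul_of_nonneg_left ?_ hM)⟩
  -- The product carries the sup norm, which the Euclidean one dominates.
  rw [Prod.norm_def]
  refine max_le (Real.abs_le_sqrt ?_) (Real.abs_le_sqrt ?_)
  · exact le_add_of_nonneg_right (sq_nonneg _)
  · exact le_add_of_nonneg_left (sq_nonneg _)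

end E3

/-! ### Assembly of the main theorem. -/

theorem IsCompact.exists_pos_forall_le {E : Type*} [TopologicalSpace E] {N : Set E}
    (hN : IsCompact N) {f : E → ℝ} (hf : ContinuousOn f N) (hpos : ∀ u ∈ N, 0 < f u) :
    ∃ κ > 0, ∀ u ∈ N, κ ≤ f u := by
  rcases N.eq_empty_or_nonempty with rfl | hne
  · exact ⟨1, one_pos, by simp⟩
  · obtain ⟨p, hp, hmin⟩ := hN.exists_isMinOn hne hf
    exact ⟨f p, hpos p hp, fun u hu => hmin hu⟩

theorem mainTheorem1
    (U V : Set E3) (hU : IsOpen U) (hV : IsOpen V) (hVU : V ⊆ U)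
    (ν H C : E3 → ℝ)
    (hν : ContDiffOn ℝ ∞ ν U) (hH : ContDiffOn ℝ ∞ H U) (hC : ContDiffOn ℝ ∞ C U)
    (hind : E3.FunctionallyIndependentOn H C V)
    (γ : ℝ → E3) (T : ℝ) (Γ : Set E3)
    (hΓ : IsPeriodicOrbit (E3.hamField ν H C) U γ T Γ) (hΓV : Γ ⊆ V)
    (h c : ℝ) (hlevel : ∀ u ∈ Γ, H u = h ∧ C u = c)
    (hreg : IsRegularValueOn (fun u => (H u, C u)) U (h, c))
    (hregH : IsRegularValueOn H U h) (hregC : IsRegularValueOn C U c)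
    (α β : E3 → ℝ)
    (hα : ContDiffOn ℝ ∞ α V) (hβ : ContDiffOn ℝ ∞ β V)
    (hαpos : ∀ u ∈ V, 0 < α u) (hβpos : ∀ u ∈ V, 0 < β u) :
    IsPeriodicOrbit (E3.perturbedField ν H C α β h c) V γ T Γ ∧
    OrbitallyPhaseAsymptoticallyStable (E3.perturbedField ν H C α β h c) V γ Γ ∧
    ∀ W : Set E3, IsOpen W → Γ ⊆ W → W ⊆ V →
      ¬ IsConservedOn H (E3.perturbedField ν H C α β h c) W ∧
      ¬ IsConservedOn C (E3.perturbedField ν H C α β h c) W := by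
  replace hν := hν.mono hVU
  replace hH := hH.mono hVU
  replace hC := hC.mono hVU
  have hHd : ∀ u ∈ V, ContDiffAt ℝ ∞ H u := fun u hu => hH.contDiffAt (hV.mem_nhds hu)
  have hCd : ∀ u ∈ V, ContDiffAt ℝ ∞ C u := fun u hu => hC.contDiffAt (hV.mem_nhds hu)
  have hcross : ∀ u ∈ V, 0 < ‖E3.cross (gradient H u) (gradient C u)‖ ^ 2 := fun u hu =>
    pow_pos (norm_pos_iff.2 (E3.cross_ne_zero (hind u hu))) 2
  have hcrossc : ContinuousOn (fun u => ‖E3.cross (gradient H u) (gradient C u)‖ ^ 2) V :=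
    ((hH.gradient_of_isOpen hV).cross (hC.gradient_of_isOpen hV)).continuousOn.norm.pow 2
  have hX := E3.contDiffOn_perturbedField (h := h) (c := c) hV hν hH hC hα hβ
  have hXΓ : ∀ u ∈ Γ, E3.perturbedField ν H C α β h c u = E3.hamField ν H C u := fun u hu =>
    E3.perturbedField_of_level (hlevel u hu).1 (hlevel u hu).2
  have hper : IsPeriodicOrbit (E3.perturbedField ν H C α β h c) V γ T Γ := by
    refine ⟨hΓ.period_pos, hΓ.periodic, ⟨fun t _ => hΓV (hΓ.mem_orbit t), fun t ht => ?_⟩,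
      hΓ.nonconstant, hΓ.orbit_eq⟩
    beta_reduce
    rw [hXΓ _ (hΓ.mem_orbit t)]
    exact hΓ.solution.2 t ht
  obtain ⟨R, hR, hRV, Y, K, L, hY, hL, hYX⟩ :=
    (hX.of_le (by exact_mod_cast le_top)).exists_lipschitzWith_eqOn_cthickening
      hV hper.isCompact hΓV
  have hX0 := hper.ne_zero hY (hYX.mono (Metric.self_subset_cthickening Γ))
  obtain ⟨M, hM, hev⟩ := E3.eventually_infDist_le_level_gap hper hXΓ hX0
    (fun u hu => hX.continuousOn.continuousAt (hV.mem_nhds (hΓV hu)))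
    (fun u hu => (hHd u (hΓV hu)).of_le (by exact_mod_cast le_top))
    (fun u hu => (hCd u (hΓV hu)).of_le (by exact_mod_cast le_top)) hlevel
  obtain ⟨R', hR', hdist⟩ :=
    (Metric.hasBasis_nhdsSet_cthickening hper.isCompact).eventually_iff.1 hev
  -- One radius for which both the Lipschitz replacement of the field and the distance estimate are
  -- valid.
  obtain ⟨r, hr, hrR, hrR'⟩ : ∃ r > 0, r ≤ R ∧ r ≤ R' :=
    ⟨min R R', lt_min hR hR', min_le_left _ _, min_le_right _ _⟩
  have hrsub : Metric.cthickening r Γ ⊆ Metric.cthickening R Γ := Metric.cthickening_mono hrR Γ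
  have hrV := hrsub.trans hRV
  have hN : IsCompact (Metric.cthickening r Γ) := hper.isCompact.cthickening
  obtain ⟨κ₁, hκ₁, hακ⟩ := hN.exists_pos_forall_le
    ((hα.continuousOn.mul hcrossc).mono hrV)
    fun u hu => mul_pos (hαpos u (hrV hu)) (hcross u (hrV hu))
  obtain ⟨κ₂, hκ₂, hβκ⟩ := hN.exists_pos_forall_le
    ((hβ.continuousOn.mul hcrossc).mono hrV)
    fun u hu => mul_pos (hβpos u (hrV hu)) (hcross u (hrV hu))
  have hstable : OrbitallyPhaseAsymptoticallyStable (E3.perturbedField ν H C α β h c) V γ Γ := by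
    refine hper.orbitallyPhaseAsymptoticallyStable hr hrV hY hL (hYX.mono hrsub)
      (G := fun u => (H u - h) ^ 2 + (C u - c) ^ 2) (κ := 2 * min κ₁ κ₂) ?_
      (fun u => by positivity) (fun u hu => by simp [hlevel u hu])
      (mul_pos two_pos (lt_min hκ₁ hκ₂)) hM
      (fun u hu => hdist (Metric.cthickening_mono hrR' Γ hu)) fun x t ht hxN hx => ?_
    · exact (((hH.continuousOn.sub continuousOn_const).pow 2).add
        ((hC.continuousOn.sub continuousOn_const).pow 2)).mono hrV
    · exact E3.level_gap_le_of_isIntegralCurveOn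
        (fun u hu => (hHd u (hrV hu)).differentiableAt (by simp))
        (fun u hu => (hCd u (hrV hu)).differentiableAt (by simp))
        (fun u hu => (min_le_left _ _).trans (hακ u hu))
        (fun u hu => (min_le_right _ _).trans (hβκ u hu)) ht hxN hx
  refine ⟨hper, hstable, fun W hW hΓW hWV => ?_⟩
  have hp := hper.mem_orbit 0
  have hpind := hind _ (hΓV hp)
  refine ⟨?_, ?_⟩
  · refine E3.not_isConservedOn_of_orbitallyStable hstable.1.1 hper.isCompact hW hΓW hWV hp
      (fun u hu => (hHd u (hWV hu)).differentiableAt (by simp)) (hpind.ne_zero 0)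
      fun u hu huh => ?_
    rw [(hlevel _ hp).1] at huh
    rw [E3.inner_gradient_left_perturbedField]
    exact neg_ne_zero.2 (mul_ne_zero (mul_pos (hαpos u (hWV hu)) (hcross u (hWV hu))).ne'
      (sub_ne_zero.2 huh))
  · refine E3.not_isConservedOn_of_orbitallyStable hstable.1.1 hper.isCompact hW hΓW hWV hp
      (fun u hu => (hCd u (hWV hu)).differentiableAt (by simp)) (hpind.ne_zero 1)
      fun u hu huc => ?_
    rw [(hlevel _ hp).2] at huc
    rw [E3.inner_gradient_right_perturbedField]
    exact neg_ne_zero.2 (mul_ne_zero (mul_pos (hβpos u (hWV hu)) (hcross u (hWV hu))).ne'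
      (sub_ne_zero.2 huc))
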